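/- Let $\hbar>0$, let $\mu$ be a Borel probability measure on $\mathbb R$ that is not a Dirac mass (for instance $d\mu=\tilde g(p)\,dp$ with a probability density $\tilde g$), and put $g(\xi)=\int e^{ip\xi/\hbar}\,d\mu(p)$. Let $\mathcal H=L^2(\mathbb R)$, let $\mathcal T_1(\mathcal H)$ be the space of trace class operators on $\mathcal H$, let $X$ be the position operator, and let $$\Delta_g(\rho)=\int e^{ipX/\hbar}\,\rho\,e^{-ipX/\hbar}\,d\mu(p),\qquad\text{i.e.}\quad \Delta_g:\rho(x,y)\mapsto g(x-y)\rho(x,y),$$ be the associated dephasing channel on $\mathcal T_1(\mathcal H)$. The $l_2$ $g$-dephasing loss is $C_2^g(\rho)=\|\rho\|_2^2-\|\Delta_g(\rho)\|_2^2$, with $\|\cdot\|_2$ the Hilbert--Schmidt norm. A linear map $\Lambda$ on $\mathcal T_1(\mathcal H)$ is dephasing-covariant if $\Lambda\circ\Delta_g=\Delta_g\circ\Lambda$, and $\mathcal{DIO}_g$ is the class of completely positive trace preserving dephasing-covariant maps. A functional $C$ is strongly monotone under $\mathcal{DIO}_g$ if $$C(\rho)\ge\sum_k p_k\,C(\rho_k),\qquad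 p_k=\operatorname{Tr}\Lambda_k(\rho),\quad \rho_k=\Lambda_k(\rho)/p_k,$$ for every state $\rho$ and every finite instrument $(\Lambda_k)_k$ with completely positive dephasing-covariant branches and trace preserving sum (terms with $p_k=0$ are read as $0$). Proposition. $C_2^g$ is not strongly monotone under $\mathcal{DIO}_g$. Explicitly, let $\phi\in L^2(\mathbb R)$ be normalized and vanish almost everywhere outside a bounded measurable set $C$ (for instance its support), and let $a,b\in\mathbb R$ be such that $A=C+a$ and $B=C+b$ are disjoint. Let $(V_x\psi)(s)=\psi(s-x)$, let $P_S$ be multiplication by the indicator function of $S$, and let $\phi_x=V_x\phi$. Put $$K_A=V_{-a}P_A,\quad K_B=V_{-b}P_B,\quad K_0=P_{(A\cup B)^c},\qquad \Lambda_j(\rho)=K_j\rho K_j^\dagger,\qquad \rho=\tfrac12|\phi_a\rangle\langle\phi_a|+\tfrac12|\phi_b\rangle\langle\phi_b|.$$ Then $\sum_jK_j^\dagger K_j=\mathbb 1$, the $\Lambda_j$ are completely positive and dephasing-covariant with $\sum_j\Lambda_j\in\mathcal{DIO}_g$, $\rho$ is a state, $p_A=p_B=\tfrac12$, $p_0=0$,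 $\rho_A=\rho_B=|\phi\rangle\langle\phi|$, $$\sum_j p_j\,C_2^g(\rho_j)=C_2^g(|\phi\rangle\langle\phi|),\qquad C_2^g(\rho)=\tfrac12\,C_2^g(|\phi\rangle\langle\phi|),$$ and therefore $\sum_jp_jC_2^g(\rho_j)>C_2^g(\rho)$ whenever $C_2^g(|\phi\rangle\langle\phi|)>0$. Data $(\phi,C,a,b)$ as above with $C_2^g(|\phi\rangle\langle\phi|)>0$ exist. -/

import Mathlib

open MeasureTheory InnerProductSpace
open scoped ENNReal ComplexOrder

noncomputable section

namespace PositionCoherence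

/-- The space `L²(ℝ)` of square-integrable wave functions. -/
abbrev H : Type := Lp ℂ 2 (volume : Measure ℝ)

/-! ### Trace class operators, trace, Hilbert-Schmidt norm -/

/-- `T` is trace class (equivalently, on a Hilbert space, nuclear): it is a sum of rank-one
operators `|x n⟩⟨y n|` with `∑ ‖x n‖ ‖y n‖ < ∞`. -/
def IsTraceClass (T : H →L[ℂ] H) : Prop :=
  ∃ x y : ℕ → H, Summable (fun n => ‖x n‖ * ‖y n‖) ∧ HasSum (fun n => rankOne ℂ (x n) (y n)) T

/-- A nuclear sum over an arbitrary index type can be rearranged into a sequence. -/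
theorem isTraceClass_of_hasSum {ι : Type*} {T : H →L[ℂ] H} (x y : ι → H)
    (hs : Summable (fun i => ‖x i‖ * ‖y i‖))
    (hT : HasSum (fun i => rankOne ℂ (x i) (y i)) T) : IsTraceClass T := by
  have hc : (Function.support fun i => ‖x i‖ * ‖y i‖).Countable := hs.countable_support
  set S := Function.support fun i => ‖x i‖ * ‖y i‖ with hS
  have : Countable S := hc
  obtain ⟨e, he⟩ := exists_injective_nat S
  have hs' : Summable (fun i : S => ‖x i‖ * ‖y i‖) := hs.subtype S
  have hT' : HasSum (fun i : S => rankOne ℂ (x i) (y i)) T := by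
    have hsub : Function.support (fun i => rankOne ℂ (x i) (y i)) ⊆ S := by
      intro i hi
      rw [hS, Function.mem_support, ← norm_rankOne (𝕜 := ℂ)]
      exact norm_ne_zero_iff.mpr hi
    exact (hasSum_subtype_iff_of_support_subset
      (f := fun i => rankOne ℂ (x i) (y i)) hsub).mpr hT
  refine ⟨Function.extend e (fun i : S => x i) 0, Function.extend e (fun i : S => y i) 0, ?_, ?_⟩
  · have h := (hasSum_extend_zero he).mpr hs'.hasSum
    refine h.summable.congr fun n => ?_
    by_cases hn : ∃ i, e i = n
    · obtain ⟨i, rfl⟩ := hn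
      simp [he.extend_apply]
    · simp [Function.extend_apply' _ _ _ hn]
  · have h := (hasSum_extend_zero he).mpr hT'
    convert h using 2 with n
    by_cases hn : ∃ i, e i = n
    · obtain ⟨i, rfl⟩ := hn
      simp [he.extend_apply]
    · simp [Function.extend_apply' _ _ _ hn]

/-- The space `𝒯₁(H)` of trace class operators. -/
def TraceClass : Submodule ℂ (H →L[ℂ] H) where
  carrier := {T | IsTraceClass T}
  zero_mem' := ⟨0, 0, by simp, by simp⟩
  add_mem' := by
    rintro S T ⟨x, y, h, hS⟩ ⟨x', y', h', hT⟩
    refine isTraceClass_of_hasSum (Sum.elim x x') (Sum.elim y y') ?_ ?_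
    · exact (h.hasSum.sum (f := fun i => ‖Sum.elim x x' i‖ * ‖Sum.elim y y' i‖) h'.hasSum).summable
    · exact HasSum.sum (f := fun i => rankOne ℂ (Sum.elim x x' i) (Sum.elim y y' i)) hS hT
  smul_mem' := by
    rintro c T ⟨x, y, h, hT⟩
    refine ⟨fun n => c • x n, y, ?_, ?_⟩
    · simpa [norm_smul, mul_assoc] using h.mul_left ‖c‖
    · simpa using hT.const_smul c

/-- The index set of a fixed orthonormal (Hilbert) basis of `L²(ℝ)`. -/
def basisIndex : Set H := (exists_hilbertBasis ℂ H).choose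

/-- A fixed orthonormal (Hilbert) basis of `L²(ℝ)`. -/
def basis : HilbertBasis basisIndex ℂ H := (exists_hilbertBasis ℂ H).choose_spec.choose

/-- The trace `Tr T = ∑ᵢ ⟨eᵢ, T eᵢ⟩` of a trace class operator (it does not depend on the basis). -/
def trace (T : TraceClass) : ℂ := ∑' i, inner ℂ (basis i) ((T : H →L[ℂ] H) (basis i))

/-- The squared Hilbert-Schmidt norm `‖T‖₂² = Tr(T† T) = ∑ᵢ ‖T eᵢ‖²` of a trace class operator. -/
def hsNormSq (T : TraceClass) : ℝ := ∑' i, ‖(T : H →L[ℂ] H) (basis i)‖ ^ 2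

/-- A (normal) state: a positive trace class operator of trace one. -/
def IsState (ρ : TraceClass) : Prop := (ρ : H →L[ℂ] H).IsPositive ∧ trace ρ = 1

/-- The rank-one operator `|φ⟩⟨φ|`. -/
def ketbra (φ : H) : TraceClass :=
  ⟨rankOne ℂ φ φ, isTraceClass_of_hasSum (fun _ : Unit => φ) (fun _ => φ)
    (Summable.of_finite) (by simp)⟩

/-! ### Operations -/

/-- Complete positivity: every ampliation `Λ ⊗ id` to `n × n` matrices of trace class operators
maps positive operators on `H ⊕ ⋯ ⊕ H` to positive operators. -/
def IsCompletelyPositive (Λ : TraceClass →ₗ[ℂ] TraceClass) : Prop :=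
  ∀ (n : ℕ) (T : Fin n → Fin n → TraceClass),
    (∀ v : Fin n → H, 0 ≤ ∑ i, ∑ j, inner ℂ (v i) ((T i j : H →L[ℂ] H) (v j))) →
    ∀ v : Fin n → H, 0 ≤ ∑ i, ∑ j, inner ℂ (v i) ((Λ (T i j) : H →L[ℂ] H) (v j))

/-- Trace preservation. -/
def IsTracePreserving (Λ : TraceClass →ₗ[ℂ] TraceClass) : Prop :=
  ∀ T, trace (Λ T) = trace T

/-- The operation `T ↦ K T K†` with the single Kraus operator `K`. -/
def krausMap (K : H →L[ℂ] H) : TraceClass →ₗ[ℂ] TraceClass where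
  toFun T := ⟨K ∘L (T : H →L[ℂ] H) ∘L K.adjoint, by
    obtain ⟨x, y, h, hT⟩ := T.2
    refine ⟨fun n => K (x n), fun n => K (y n), ?_, ?_⟩
    · refine Summable.of_nonneg_of_le (fun n => by positivity) (fun n => ?_)
        (h.mul_left (‖K‖ * ‖K‖))
      calc ‖K (x n)‖ * ‖K (y n)‖ ≤ (‖K‖ * ‖x n‖) * (‖K‖ * ‖y n‖) := by
            gcongr <;> exact K.le_opNorm _
        _ = ‖K‖ * ‖K‖ * (‖x n‖ * ‖y n‖) := by ring
    · have h1 := hT.mapL ((ContinuousLinearMap.compL ℂ H H H).flip K.adjoint)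
      have h2 := h1.mapL (ContinuousLinearMap.compL ℂ H H H K)
      convert h2 using 2 with n
      · ext1 v
        simp [ContinuousLinearMap.adjoint_inner_right]
      · rfl⟩
  map_add' S T := by ext1; simp [ContinuousLinearMap.add_comp, ContinuousLinearMap.comp_add]
  map_smul' c T := by ext1; simp [ContinuousLinearMap.smul_comp]

/-! ### Multiplication, projection and translation operators -/

/-- Multiplication by an essentially bounded function. -/
def mulOp (f : ℝ → ℂ) (hf : MemLp f ∞ volume) : H →L[ℂ] H :=
  (ContinuousLinearMap.mul ℂ ℂ).holderL volume ∞ 2 2 (hf.toLp f)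

theorem mulOp_coe (f : ℝ → ℂ) (hf : MemLp f ∞ volume) (φ : H) :
    mulOp f hf φ =ᵐ[volume] fun x => f x * φ x := by
  have h := (ContinuousLinearMap.mul ℂ ℂ).coeFn_holder (r := 2) (hf.toLp f) φ
  refine Filter.EventuallyEq.trans (by exact h) ?_
  filter_upwards [hf.coeFn_toLp] with x hx
  simp [hx]

/-- The projection `P_S` onto wave functions supported in the measurable set `S`. -/
def projOp (S : Set ℝ) (hS : MeasurableSet S) : H →L[ℂ] H :=
  mulOp (S.indicator fun _ => 1) (memLp_top_const (1 : ℂ) |>.indicator hS)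

/-- The translation `V_a`, `(V_a φ)(x) = φ(x - a)`. -/
def transOp (a : ℝ) : H →L[ℂ] H :=
  (Lp.compMeasurePreservingₗᵢ ℂ (fun x : ℝ => x - a)
    (measurePreserving_sub_right volume a)).toContinuousLinearMap

/-- The function `x ↦ e^{i p x / ħ}`. -/
def kickFun (ħ p : ℝ) (x : ℝ) : ℂ := Complex.exp ((p * x / ħ : ℝ) * Complex.I)

theorem norm_kickFun (ħ p x : ℝ) : ‖kickFun ħ p x‖ = 1 := Complex.norm_exp_ofReal_mul_I _

theorem memLp_kickFun (ħ p : ℝ) : MemLp (kickFun ħ p) ∞ volume :=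
  memLp_top_of_bound (by unfold kickFun; fun_prop) 1
    (Filter.Eventually.of_forall fun x => (norm_kickFun ħ p x).le)

/-- The momentum kick `e^{i p X / ħ}`, multiplication by `x ↦ e^{i p x / ħ}`. -/
def kick (ħ p : ℝ) : H →L[ℂ] H := mulOp (kickFun ħ p) (memLp_kickFun ħ p)

theorem kick_coe (ħ p : ℝ) (φ : H) :
    kick ħ p φ =ᵐ[volume] fun x => kickFun ħ p x * φ x := mulOp_coe _ _ _

theorem norm_kick (ħ p : ℝ) (φ : H) : ‖kick ħ p φ‖ = ‖φ‖ := by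
  rw [Lp.norm_def, Lp.norm_def]
  congr 1
  refine eLpNorm_congr_norm_ae ?_
  filter_upwards [kick_coe ħ p φ] with x hx
  rw [hx, norm_mul, norm_kickFun, one_mul]

theorem adjoint_kick (ħ p : ℝ) : (kick ħ p).adjoint = kick ħ (-p) := by
  symm
  rw [ContinuousLinearMap.eq_adjoint_iff]
  intro v w
  rw [L2.inner_def, L2.inner_def]
  refine integral_congr_ae ?_
  filter_upwards [kick_coe ħ (-p) v, kick_coe ħ p w] with x h1 h2
  have : (starRingEnd ℂ) (kickFun ħ (-p) x) = kickFun ħ p x := by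
    simp only [kickFun, ← Complex.exp_conj, map_mul, Complex.conj_ofReal, Complex.conj_I]
    congr 1
    push_cast
    ring
  rw [h1, h2]
  simp only [RCLike.inner_apply, map_mul, this]
  ring

theorem continuous_kick (ħ : ℝ) (φ : H) : Continuous fun p => kick ħ p φ := by
  have hin : ∀ q, Continuous fun p => inner ℂ (kick ħ q φ) (kick ħ p φ) := by
    intro q
    have h1 : ∀ p, inner ℂ (kick ħ q φ) (kick ħ p φ) =
        ∫ x, kickFun ħ p x * φ x * (starRingEnd ℂ) (kickFun ħ q x * φ x) := by
      intro p
      rw [L2.inner_def]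
      refine integral_congr_ae ?_
      filter_upwards [kick_coe ħ q φ, kick_coe ħ p φ] with x h1 h2
      rw [h1, h2, RCLike.inner_apply]
    simp_rw [h1]
    refine continuous_of_dominated (bound := fun x => ‖φ x‖ ^ 2) ?_ ?_ ?_ ?_
    · intro p
      have := (Lp.memLp φ).aestronglyMeasurable
      refine AEStronglyMeasurable.mul ((memLp_kickFun ħ p).aestronglyMeasurable.mul this) ?_
      exact Complex.continuous_conj.comp_aestronglyMeasurable
        ((memLp_kickFun ħ q).aestronglyMeasurable.mul this)
    · intro p
      refine Filter.Eventually.of_forall fun x => le_of_eq ?_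
      rw [norm_mul, RCLike.norm_conj, norm_mul, norm_mul, norm_kickFun, norm_kickFun]
      ring
    · exact (Lp.memLp φ).integrable_norm_pow (by norm_num)
    · refine Filter.Eventually.of_forall fun x => ?_
      unfold kickFun
      fun_prop
  refine continuous_iff_continuousAt.mpr fun q => ?_
  have h2 : ∀ p, ‖kick ħ p φ - kick ħ q φ‖ ^ 2 =
      2 * ‖φ‖ ^ 2 - 2 * (inner ℂ (kick ħ q φ) (kick ħ p φ)).re := by
    intro p
    rw [@norm_sub_rev, @norm_sub_sq ℂ, norm_kick, norm_kick]
    simp only [RCLike.re_to_complex]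
    ring
  have h3 : Filter.Tendsto (fun p => ‖kick ħ p φ - kick ħ q φ‖ ^ 2) (nhds q) (nhds 0) := by
    have hc : Continuous fun p => ‖kick ħ p φ - kick ħ q φ‖ ^ 2 := by
      simp_rw [h2]
      exact continuous_const.sub (continuous_const.mul (Complex.continuous_re.comp (hin q)))
    simpa using hc.tendsto q
  rw [ContinuousAt, tendsto_iff_norm_sub_tendsto_zero]
  have h4 := h3.sqrt
  simpa [Real.sqrt_sq] using h4

/-! ### The dephasing channel -/

theorem continuous_kick_conj (ħ : ℝ) (T : H →L[ℂ] H) (v : H) :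
    Continuous fun p => kick ħ p (T ((kick ħ p).adjoint v)) := by
  have hw : Continuous fun p => T ((kick ħ p).adjoint v) := by
    simp_rw [adjoint_kick]
    exact T.continuous.comp ((continuous_kick ħ v).comp continuous_neg)
  refine continuous_iff_continuousAt.mpr fun q => ?_
  rw [ContinuousAt, tendsto_iff_norm_sub_tendsto_zero]
  have h1 : Filter.Tendsto (fun p => ‖T ((kick ħ p).adjoint v) - T ((kick ħ q).adjoint v)‖ +
      ‖kick ħ p (T ((kick ħ q).adjoint v)) - kick ħ q (T ((kick ħ q).adjoint v))‖)
      (nhds q) (nhds 0) := by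
    have a := tendsto_iff_norm_sub_tendsto_zero.mp (hw.tendsto q)
    have b := tendsto_iff_norm_sub_tendsto_zero.mp
      ((continuous_kick ħ (T ((kick ħ q).adjoint v))).tendsto q)
    simpa using a.add b
  refine squeeze_zero (fun _ => norm_nonneg _) (fun p => ?_) h1
  rw [← norm_kick ħ p (T ((kick ħ p).adjoint v) - T ((kick ħ q).adjoint v)), map_sub]
  exact norm_sub_le_norm_sub_add_norm_sub _ _ _

theorem norm_kick_conj_le (ħ : ℝ) (T : H →L[ℂ] H) (v : H) (p : ℝ) :
    ‖kick ħ p (T ((kick ħ p).adjoint v))‖ ≤ ‖T‖ * ‖v‖ := by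
  rw [norm_kick, ← norm_kick ħ (-p) v, adjoint_kick]
  exact T.le_opNorm _

theorem integrable_kick_conj (ħ : ℝ) (μ : Measure ℝ) [IsProbabilityMeasure μ]
    (T : H →L[ℂ] H) (v : H) : Integrable (fun p => kick ħ p (T ((kick ħ p).adjoint v))) μ :=
  Integrable.of_bound (continuous_kick_conj ħ T v).aestronglyMeasurable (‖T‖ * ‖v‖)
    (Filter.Eventually.of_forall (norm_kick_conj_le ħ T v))

/-- The random momentum kick map on bounded operators,
`T ↦ ∫ e^{i p X / ħ} T e^{-i p X / ħ} dμ(p)`, the integral being taken in the strong sense. -/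
def dephaseBounded (ħ : ℝ) (μ : Measure ℝ) [IsProbabilityMeasure μ] :
    (H →L[ℂ] H) →L[ℂ] (H →L[ℂ] H) :=
  LinearMap.mkContinuous₂
    { toFun T :=
        { toFun v := ∫ p, kick ħ p (T ((kick ħ p).adjoint v)) ∂μ
          map_add' v w := by
            simp only [map_add]
            exact integral_add (integrable_kick_conj ħ μ T v) (integrable_kick_conj ħ μ T w)
          map_smul' c v := by
            simp only [map_smul, RingHom.id_apply]
            exact integral_smul c _ }
      map_add' S T := by
        ext1 v
        simp only [add_apply, map_add, LinearMap.coe_mk, AddHom.coe_mk,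
          LinearMap.add_apply]
        exact integral_add (integrable_kick_conj ħ μ S v) (integrable_kick_conj ħ μ T v)
      map_smul' c T := by
        ext1 v
        simp only [smul_apply, map_smul, LinearMap.coe_mk, AddHom.coe_mk,
          LinearMap.smul_apply, RingHom.id_apply]
        exact integral_smul c _ } 1 (by
    intro T v
    simp only [LinearMap.coe_mk, AddHom.coe_mk, one_mul]
    simpa using norm_integral_le_of_norm_le_const
      (Filter.Eventually.of_forall (f := ae μ) (norm_kick_conj_le ħ T v)))

theorem dephaseBounded_apply (ħ : ℝ) (μ : Measure ℝ) [IsProbabilityMeasure μ]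
    (T : H →L[ℂ] H) (v : H) :
    dephaseBounded ħ μ T v = ∫ p, kick ħ p (T ((kick ħ p).adjoint v)) ∂μ := rfl

/-- The component of `p ↦ e^{i p X / ħ} x` along `f ∈ L²(μ)`. -/
def kickCoeff (ħ : ℝ) (μ : Measure ℝ) (f : Lp ℂ 2 μ) (x : H) : H :=
  ∫ p, (starRingEnd ℂ) (f p) • kick ħ p x ∂μ

theorem memLp_inner_kick (ħ : ℝ) (μ : Measure ℝ) [IsProbabilityMeasure μ] (w x : H) :
    MemLp (fun p => inner ℂ w (kick ħ p x)) 2 μ := by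
  refine MemLp.of_bound
    (continuous_const.inner (continuous_kick ħ x)).aestronglyMeasurable (‖w‖ * ‖x‖)
    (Filter.Eventually.of_forall fun p => ?_)
  rw [← norm_kick ħ p x]
  exact norm_inner_le_norm _ _

theorem inner_kickCoeff (ħ : ℝ) (μ : Measure ℝ) [IsProbabilityMeasure μ] (f : Lp ℂ 2 μ)
    (w x : H) :
    inner ℂ w (kickCoeff ħ μ f x) = inner ℂ f (memLp_inner_kick ħ μ w x).toLp := by
  have hf : Integrable (fun p => (starRingEnd ℂ) (f p)) μ := by
    have : Integrable f μ := (Lp.memLp f).integrable (by norm_num)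
    exact (RCLike.conjLIE (K := ℂ)).toContinuousLinearEquiv.toContinuousLinearMap.integrable_comp
      this
  have hint : Integrable (fun p => (starRingEnd ℂ) (f p) • kick ħ p x) μ :=
    hf.smul_bdd ‖x‖ (continuous_kick ħ x).aestronglyMeasurable
      (Filter.Eventually.of_forall fun p => (norm_kick ħ p x).le)
  rw [kickCoeff, ← integral_inner hint, L2.inner_def]
  refine integral_congr_ae ?_
  filter_upwards [(memLp_inner_kick ħ μ w x).coeFn_toLp] with p hp
  rw [hp, inner_smul_right, RCLike.inner_apply, mul_comm]

theorem sum_norm_kickCoeff_sq_le (ħ : ℝ) (μ : Measure ℝ) [IsProbabilityMeasure μ]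
    {ι : Type*} (f : ι → Lp ℂ 2 μ) (hf : Orthonormal ℂ f) (x : H) (s : Finset ι) :
    ∑ i ∈ s, ‖kickCoeff ħ μ (f i) x‖ ^ 2 ≤ ‖x‖ ^ 2 := by
  have hpar : ∀ v : H, HasSum (fun k => ‖inner ℂ (basis k) v‖ ^ 2) (‖v‖ ^ 2) := by
    intro v
    have h := (basis.hasSum_inner_mul_inner v v).mapL Complex.reCLM
    convert h using 1
    · ext k
      rw [← inner_conj_symm v, Complex.reCLM_apply, Complex.conj_mul']
      norm_cast
    · rw [Complex.reCLM_apply, inner_self_eq_norm_sq_to_K]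
      norm_cast
  have h1 := hasSum_sum fun i (_ : i ∈ s) => hpar (kickCoeff ħ μ (f i) x)
  refine le_of_tendsto h1 (Filter.Eventually.of_forall fun t => ?_)
  calc ∑ k ∈ t, ∑ i ∈ s, ‖inner ℂ (basis k) (kickCoeff ħ μ (f i) x)‖ ^ 2
      ≤ ∑ k ∈ t, ‖(memLp_inner_kick ħ μ (basis k) x).toLp‖ ^ 2 := by
        refine Finset.sum_le_sum fun k _ => ?_
        simp_rw [inner_kickCoeff]
        exact hf.sum_inner_products_le _
    _ = ∑ k ∈ t, ∫ p, ‖inner ℂ (basis k : H) (kick ħ p x)‖ ^ 2 ∂μ := by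
        refine Finset.sum_congr rfl fun k _ => ?_
        have := @inner_self_eq_norm_sq ℂ _ _ _ _ (memLp_inner_kick ħ μ (basis k) x).toLp
        rw [← this, L2.inner_def, ← integral_re (L2.integrable_inner _ _)]
        refine integral_congr_ae ?_
        filter_upwards [(memLp_inner_kick ħ μ (basis k) x).coeFn_toLp] with p hp
        rw [hp, inner_self_eq_norm_sq]
    _ = ∫ p, ∑ k ∈ t, ‖inner ℂ (basis k : H) (kick ħ p x)‖ ^ 2 ∂μ := by
        rw [integral_finsetSum]
        intro k _
        exact (memLp_inner_kick ħ μ (basis k) x).integrable_norm_pow (by norm_num)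
    _ ≤ ∫ _, ‖x‖ ^ 2 ∂μ := by
        refine integral_mono ?_ (integrable_const _) fun p => ?_
        · refine integrable_finsetSum _ fun k _ => ?_
          exact (memLp_inner_kick ħ μ (basis k) x).integrable_norm_pow (by norm_num)
        · simp only
          rw [← norm_kick ħ p x]
          exact basis.orthonormal.sum_inner_products_le _
    _ = ‖x‖ ^ 2 := by simp

/-- The random momentum kick map sends trace class operators to trace class operators. -/
theorem isTraceClass_dephaseBounded (ħ : ℝ) (μ : Measure ℝ) [IsProbabilityMeasure μ]
    (T : H →L[ℂ] H) (hT : IsTraceClass T) : IsTraceClass (dephaseBounded ħ μ T) := by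
  obtain ⟨x, y, hs, hT⟩ := hT
  obtain ⟨w, f, -⟩ := exists_hilbertBasis ℂ (Lp ℂ 2 μ)
  have hcs : ∀ u z : H,
      Summable (fun i => ‖kickCoeff ħ μ (f i) u‖ * ‖kickCoeff ħ μ (f i) z‖) ∧
      ∑' i, ‖kickCoeff ħ μ (f i) u‖ * ‖kickCoeff ħ μ (f i) z‖ ≤ ‖u‖ * ‖z‖ := by
    intro u z
    have key : ∀ s : Finset w, ∑ i ∈ s, ‖kickCoeff ħ μ (f i) u‖ * ‖kickCoeff ħ μ (f i) z‖ ≤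
        ‖u‖ * ‖z‖ := by
      intro s
      refine (Real.sum_mul_le_sqrt_mul_sqrt s _ _).trans ?_
      gcongr
      · exact Real.sqrt_le_iff.mpr ⟨norm_nonneg _,
          sum_norm_kickCoeff_sq_le ħ μ f f.orthonormal u s⟩
      · exact Real.sqrt_le_iff.mpr ⟨norm_nonneg _,
          sum_norm_kickCoeff_sq_le ħ μ f f.orthonormal z s⟩
    exact ⟨summable_of_sum_le (fun _ => by positivity) key,
      Real.tsum_le_of_sum_le (fun _ => by positivity) key⟩
  have hone : ∀ u z : H, HasSum
      (fun i => rankOne ℂ (kickCoeff ħ μ (f i) u) (kickCoeff ħ μ (f i) z))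
      (dephaseBounded ħ μ (rankOne ℂ u z)) := by
    intro u z
    have hsum : Summable
        (fun i => rankOne ℂ (kickCoeff ħ μ (f i) u) (kickCoeff ħ μ (f i) z)) :=
      Summable.of_norm (by simpa using (hcs u z).1)
    convert hsum.hasSum
    ext1 v
    refine ext_inner_left ℂ fun t => ?_
    have h1 := (hsum.hasSum.mapL (ContinuousLinearMap.apply ℂ H v)).mapL (innerSL ℂ t)
    have h2 := f.hasSum_inner_mul_inner (memLp_inner_kick ħ μ v z).toLp
      (memLp_inner_kick ħ μ t u).toLp
    have h3 : inner ℂ (memLp_inner_kick ħ μ v z).toLp (memLp_inner_kick ħ μ t u).toLp =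
        inner ℂ t (dephaseBounded ħ μ (rankOne ℂ u z) v) := by
      rw [dephaseBounded_apply, ← integral_inner (integrable_kick_conj ħ μ _ v), L2.inner_def]
      refine integral_congr_ae ?_
      filter_upwards [(memLp_inner_kick ħ μ v z).coeFn_toLp,
        (memLp_inner_kick ħ μ t u).coeFn_toLp] with p h1 h2
      rw [h1, h2, rankOne_apply, map_smul, inner_smul_right,
        ContinuousLinearMap.adjoint_inner_right, RCLike.inner_apply, inner_conj_symm, mul_comm]
    rw [h3] at h2
    refine h2.unique ?_
    convert h1 using 1
    · ext i
      rw [← inner_kickCoeff, ← inner_conj_symm, ← inner_kickCoeff, inner_conj_symm]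
      simp
    · rfl
  have hprod : Summable (fun q : ℕ × w =>
      ‖kickCoeff ħ μ (f q.2) (x q.1)‖ * ‖kickCoeff ħ μ (f q.2) (y q.1)‖) := by
    rw [summable_prod_of_nonneg (fun _ => by positivity)]
    exact ⟨fun n => (hcs (x n) (y n)).1, hs.of_nonneg_of_le
      (fun n => tsum_nonneg fun _ => by positivity) (fun n => (hcs (x n) (y n)).2)⟩
  have hsum : Summable (fun q : ℕ × w =>
      rankOne ℂ (kickCoeff ħ μ (f q.2) (x q.1)) (kickCoeff ħ μ (f q.2) (y q.1))) :=
    Summable.of_norm (by simpa using hprod)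
  refine isTraceClass_of_hasSum _ _ hprod ?_
  convert hsum.hasSum
  exact (hT.mapL (dephaseBounded ħ μ)).unique
    (hsum.hasSum.prod_fiberwise fun n => hone (x n) (y n))

/-- The dephasing channel `Δ_g` with momentum kicks distributed according to the probability
measure `μ`: `Δ_g(T) = ∫ e^{i p X / ħ} T e^{-i p X / ħ} dμ(p)`. In the position representation it
multiplies the kernel `T(x, y)` by `g(x - y)`, where `g(ξ) = ∫ e^{i p ξ / ħ} dμ(p)`. -/
def dephase (ħ : ℝ) (μ : Measure ℝ) [IsProbabilityMeasure μ] : TraceClass →ₗ[ℂ] TraceClass :=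
  (dephaseBounded ħ μ).toLinearMap.restrict (isTraceClass_dephaseBounded ħ μ)

/-- The `l₂` `g`-dephasing loss `C₂^g(ρ) = ‖ρ‖₂² - ‖Δ_g(ρ)‖₂²`. -/
def l2Loss (ħ : ℝ) (μ : Measure ℝ) [IsProbabilityMeasure μ] (ρ : TraceClass) : ℝ :=
  hsNormSq ρ - hsNormSq (dephase ħ μ ρ)

/-! ### Dephasing-covariant operations and strong monotonicity -/

/-- `Λ ∘ Δ_g = Δ_g ∘ Λ`. -/
def IsDephasingCovariant (ħ : ℝ) (μ : Measure ℝ) [IsProbabilityMeasure μ]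
    (Λ : TraceClass →ₗ[ℂ] TraceClass) : Prop :=
  Λ ∘ₗ dephase ħ μ = dephase ħ μ ∘ₗ Λ

/-- The class `DIO_g` of completely positive, trace preserving maps that commute with `Δ_g`. -/
def IsDIO (ħ : ℝ) (μ : Measure ℝ) [IsProbabilityMeasure μ]
    (Λ : TraceClass →ₗ[ℂ] TraceClass) : Prop :=
  IsCompletelyPositive Λ ∧ IsTracePreserving Λ ∧ IsDephasingCovariant ħ μ Λ

/-- A finite quantum instrument under `DIO_g`: the branches are completely positive and
dephasing-covariant, and their sum is trace preserving (so that the sum belongs to `DIO_g`). -/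
structure IsDIOInstrument (ħ : ℝ) (μ : Measure ℝ) [IsProbabilityMeasure μ] {n : ℕ}
    (Λ : Fin n → (TraceClass →ₗ[ℂ] TraceClass)) : Prop where
  completelyPositive : ∀ k, IsCompletelyPositive (Λ k)
  covariant : ∀ k, IsDephasingCovariant ħ μ (Λ k)
  sum_isDIO : IsDIO ħ μ (∑ k, Λ k)

/-- The probability `p = Tr Λ(ρ)` of the branch `Λ`. -/
def branchProb (Λ : TraceClass →ₗ[ℂ] TraceClass) (ρ : TraceClass) : ℝ := (trace (Λ ρ)).re

/-- The post-measurement state `Λ(ρ) / p` of the branch `Λ` (meaningful if `p ≠ 0`). -/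
def branchState (Λ : TraceClass →ₗ[ℂ] TraceClass) (ρ : TraceClass) : TraceClass :=
  ((branchProb Λ ρ : ℂ)⁻¹) • Λ ρ

/-- The average `∑ₖ pₖ C(ρₖ)` over the branches of an instrument (branches with `pₖ = 0` do not
contribute). -/
def averageAfter {n : ℕ} (C : TraceClass → ℝ) (Λ : Fin n → (TraceClass →ₗ[ℂ] TraceClass))
    (ρ : TraceClass) : ℝ :=
  ∑ k, branchProb (Λ k) ρ * C (branchState (Λ k) ρ)

/-- Strong monotonicity of `C` under `DIO_g`: `C(ρ) ≥ ∑ₖ pₖ C(ρₖ)` for all states and all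
instruments with dephasing-covariant branches. -/
def IsStronglyMonotone (ħ : ℝ) (μ : Measure ℝ) [IsProbabilityMeasure μ]
    (C : TraceClass → ℝ) : Prop :=
  ∀ (n : ℕ) (Λ : Fin n → (TraceClass →ₗ[ℂ] TraceClass)), IsDIOInstrument ħ μ Λ →
    ∀ ρ, IsState ρ → averageAfter C Λ ρ ≤ C ρ

/-! ### The two-packet mixture and its three-outcome instrument -/

/-- The translated set `C + a`. -/
def shift (C : Set ℝ) (a : ℝ) : Set ℝ := {x | x - a ∈ C}

theorem measurableSet_shift {C : Set ℝ} (hC : MeasurableSet C) (a : ℝ) :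
    MeasurableSet (shift C a) := (measurable_id.sub_const a) hC

/-- Admissible data: a normalized `φ` vanishing a.e. outside a bounded measurable set `C`, and
displacements `a`, `b` for which `C + a` and `C + b` are disjoint. -/
structure IsPacketPair (φ : H) (C : Set ℝ) (a b : ℝ) : Prop where
  norm_eq_one : ‖φ‖ = 1
  measurable : MeasurableSet C
  bounded : Bornology.IsBounded C
  vanish : ∀ᵐ x, x ∉ C → φ x = 0
  disjoint : Disjoint (shift C a) (shift C b)

/-- The Kraus operators `K_A = V_{-a} P_A`, `K_B = V_{-b} P_B`, `K_0 = P_{(A ∪ B)ᶜ}`, where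
`A = C + a` and `B = C + b`. -/
def packetKraus (C : Set ℝ) (hC : MeasurableSet C) (a b : ℝ) : Fin 3 → (H →L[ℂ] H) :=
  ![transOp (-a) ∘L projOp (shift C a) (measurableSet_shift hC a),
    transOp (-b) ∘L projOp (shift C b) (measurableSet_shift hC b),
    projOp (shift C a ∪ shift C b)ᶜ
      ((measurableSet_shift hC a).union (measurableSet_shift hC b)).compl]

/-- The instrument `T ↦ K_j T K_j†`, `j ∈ {A, B, 0}`. -/
def packetInstrument (C : Set ℝ) (hC : MeasurableSet C) (a b : ℝ) :
    Fin 3 → (TraceClass →ₗ[ℂ] TraceClass) :=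
  fun j => krausMap (packetKraus C hC a b j)

/-- The mixture `½ |φ_a⟩⟨φ_a| + ½ |φ_b⟩⟨φ_b|` of two translates `φ_x = V_x φ` of `φ`. -/
def packetMixture (φ : H) (a b : ℝ) : TraceClass :=
  (1 / 2 : ℂ) • ketbra (transOp a φ) + (1 / 2 : ℂ) • ketbra (transOp b φ)

end PositionCoherence

end

open PositionCoherence

/-!
Projections onto disjoint regions commute with the momentum kicks and have orthogonal ranges, so
`C₂^g` is additive over the two packets; being quadratic, it gives the mixture the loss
`2 · (1/2)² · C₂^g(|φ⟩⟨φ|)`. Finding out which region the particle occupies and translating it back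
restores `|φ⟩⟨φ|` with certainty, and hence its full loss. This is dephasing-covariant because a
translation commutes with each kick up to a phase, which cancels in `K T K†`.

For the strict positivity of the loss, `Δ_g(|φ⟩⟨φ|)` is the mixture of the kicked states
`φ_p = e^{ipX/ħ} φ`, so its squared Hilbert-Schmidt norm is `∫∫ |⟨φ_p, φ_q⟩|² dμ(p) dμ(q)`. The
function `e^{irx/ħ}` with `r ≠ 0` takes each value only countably often, so `φ_p` and `φ_q` are
never parallel for `p ≠ q`. The integrand is then smaller than `‖φ‖⁴` off the diagonal, and `μ ⊗ μ`
charges the complement of the diagonal unless `μ` is a Dirac mass.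
-/

namespace PositionCoherence

section HilbertSpace

variable {𝕜 E F G ι ι' κ : Type*} [RCLike 𝕜]
  [NormedAddCommGroup E] [InnerProductSpace 𝕜 E]
  [NormedAddCommGroup F] [InnerProductSpace 𝕜 F]
  [NormedAddCommGroup G] [InnerProductSpace 𝕜 G]

/-! ### Orthonormal families and Hilbert bases -/

theorem sum_norm_inner_mul_norm_inner_le {e : ι → E} (he : Orthonormal 𝕜 e) (u v : E)
    (s : Finset ι) : ∑ i ∈ s, ‖inner 𝕜 u (e i)‖ * ‖inner 𝕜 (e i) v‖ ≤ ‖u‖ * ‖v‖ := by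
  refine (Real.sum_mul_le_sqrt_mul_sqrt s _ _).trans ?_
  simp_rw [norm_inner_symm u]
  gcongr <;> exact Real.sqrt_le_iff.mpr ⟨norm_nonneg _, he.sum_inner_products_le _⟩

theorem summable_norm_inner_mul_norm_inner {e : ι → E} (he : Orthonormal 𝕜 e) (u v : E) :
    Summable fun i => ‖inner 𝕜 u (e i)‖ * ‖inner 𝕜 (e i) v‖ :=
  summable_of_sum_le (fun _ => by positivity) (sum_norm_inner_mul_norm_inner_le he u v)

theorem hasSum_norm_inner_sq (b : HilbertBasis ι 𝕜 E) (v : E) :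
    HasSum (fun i => ‖inner 𝕜 (b i) v‖ ^ 2) (‖v‖ ^ 2) := by
  have h := (b.hasSum_inner_mul_inner v v).mapL RCLike.reCLM
  simpa only [RCLike.reCLM_apply, inner_mul_symm_re_eq_norm, norm_mul, norm_inner_symm v, ← sq,
    inner_self_eq_norm_sq] using h

theorem tsum_enorm_inner_sq (b : HilbertBasis ι 𝕜 E) (v : E) :
    ∑' i, ‖inner 𝕜 (b i) v‖ₑ ^ 2 = ‖v‖ₑ ^ 2 := by
  have h := hasSum_norm_inner_sq b v
  simp only [← ofReal_norm, ← ENNReal.ofReal_pow (norm_nonneg _)]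
  rw [← h.tsum_eq, ENNReal.ofReal_tsum_of_nonneg (fun _ => by positivity) h.summable]

theorem tsum_enorm_adjoint_sq [CompleteSpace E] [CompleteSpace F] (b : HilbertBasis ι 𝕜 E)
    (c : HilbertBasis ι' 𝕜 F) (A : E →L[𝕜] F) :
    ∑' j, ‖A.adjoint (c j)‖ₑ ^ 2 = ∑' i, ‖A (b i)‖ₑ ^ 2 := by
  have enorm_entry (i : ι) (j : ι') :
      ‖inner 𝕜 (b i) (A.adjoint (c j))‖ₑ = ‖inner 𝕜 (c j) (A (b i))‖ₑ := by
    rw [A.adjoint_inner_right, ← ofReal_norm, norm_inner_symm, ofReal_norm]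
  simp_rw [← tsum_enorm_inner_sq b (A.adjoint _), ← tsum_enorm_inner_sq c (A _), enorm_entry]
  exact ENNReal.tsum_comm

theorem countable_of_orthonormal [TopologicalSpace.SeparableSpace E] {e : ι → E}
    (he : Orthonormal 𝕜 e) : Countable ι := by
  have one_le_dist {i j : ι} (hij : i ≠ j) : 1 ≤ dist (e i) (e j) := by
    have : ‖e i - e j‖ ^ 2 = 2 := by
      rw [@norm_sub_sq 𝕜, he.1, he.1, he.2 hij]
      norm_num
    rw [dist_eq_norm]
    nlinarith [norm_nonneg (e i - e j)]
  have balls_disjoint : Pairwise (Function.onFun Disjoint fun i => Metric.ball (e i) (1 / 2)) :=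
    fun i j hij => Metric.ball_disjoint_ball (by linarith [one_le_dist hij])
  exact balls_disjoint.countable_of_isOpen_disjoint (fun _ => Metric.isOpen_ball)
    fun i => ⟨e i, Metric.mem_ball_self (by norm_num)⟩

/-! ### Nuclear representations -/

/-- An expansion `T = ∑ₖ |xₖ⟩⟨yₖ|` with `∑ₖ ‖xₖ‖ ‖yₖ‖ < ∞`, over an arbitrary index type. The
trace of `T` is read off any such expansion as `∑ₖ ⟨yₖ, xₖ⟩`. -/
structure IsNuclearRepresentation (T : E →L[𝕜] F) (x : κ → F) (y : κ → E) : Prop where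
  summable_norm : Summable fun k => ‖x k‖ * ‖y k‖
  hasSum : HasSum (fun k => rankOne 𝕜 (x k) (y k)) T

namespace IsNuclearRepresentation

theorem comp_left {T : E →L[𝕜] F} {x : κ → F} {y : κ → E} (h : IsNuclearRepresentation T x y)
    (A : F →L[𝕜] G) : IsNuclearRepresentation (A ∘L T) (fun k => A (x k)) y where
  summable_norm := by
    refine (h.summable_norm.mul_left ‖A‖).of_nonneg_of_le (fun k => by positivity) fun k => ?_
    rw [← mul_assoc]
    gcongr
    exact A.le_opNorm _
  hasSum := by
    simpa only [ContinuousLinearMap.compL_apply, comp_rankOne] using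
      h.hasSum.mapL (ContinuousLinearMap.compL 𝕜 E F G A)

theorem comp_adjoint [CompleteSpace E] [CompleteSpace G] {T : E →L[𝕜] F} {x : κ → F} {y : κ → E}
    (h : IsNuclearRepresentation T x y) (B : E →L[𝕜] G) :
    IsNuclearRepresentation (T ∘L B.adjoint) x (fun k => B (y k)) where
  summable_norm := by
    refine (h.summable_norm.mul_right ‖B‖).of_nonneg_of_le (fun k => by positivity) fun k => ?_
    rw [mul_assoc, mul_comm ‖y k‖]
    gcongr
    exact B.le_opNorm _
  hasSum := by
    simpa only [ContinuousLinearMap.flip_apply, ContinuousLinearMap.compL_apply, rankOne_comp,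
      ContinuousLinearMap.adjoint_adjoint] using
      h.hasSum.mapL ((ContinuousLinearMap.compL 𝕜 G E F).flip B.adjoint)

theorem summable_inner_mul_inner {T : E →L[𝕜] E} {x y : κ → E}
    (h : IsNuclearRepresentation T x y) {e : ι → E} (he : Orthonormal 𝕜 e) :
    Summable fun q : κ × ι => inner 𝕜 (y q.1) (e q.2) * inner 𝕜 (e q.2) (x q.1) := by
  refine Summable.of_norm ?_
  simp only [norm_mul]
  rw [summable_prod_of_nonneg (fun _ => by positivity)]
  refine ⟨fun k => summable_norm_inner_mul_norm_inner he (y k) (x k),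
    h.summable_norm.of_nonneg_of_le (fun k => tsum_nonneg fun _ => by positivity) fun k => ?_⟩
  rw [mul_comm ‖x k‖]
  exact Real.tsum_le_of_sum_le (fun _ => by positivity)
    (sum_norm_inner_mul_norm_inner_le he (y k) (x k))

theorem hasSum_inner_basis {T : E →L[𝕜] E} {x y : κ → E} (h : IsNuclearRepresentation T x y)
    (b : HilbertBasis ι 𝕜 E) :
    HasSum (fun i => inner 𝕜 (b i) (T (b i))) (∑' k, inner 𝕜 (y k) (x k)) := by
  have hsummable := h.summable_inner_mul_inner b.orthonormal
  have rows := hsummable.hasSum.prod_fiberwise fun k => b.hasSum_inner_mul_inner (y k) (x k)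
  rw [rows.tsum_eq]
  refine ((Equiv.prodComm ι κ).hasSum_iff.mpr hsummable.hasSum).prod_fiberwise fun i => ?_
  have entry := h.hasSum.mapL (innerSL 𝕜 (b i) ∘L ContinuousLinearMap.apply 𝕜 E (b i))
  simpa only [Function.comp_apply, Equiv.prodComm_apply, Prod.swap_prod_mk,
    ContinuousLinearMap.coe_comp, ContinuousLinearMap.apply_apply, rankOne_apply,
    innerSL_apply_apply, inner_smul_right] using entry

end IsNuclearRepresentation

/-! ### Mixtures of rank-one operators -/

section Mixture

variable {α : Type*} [MeasurableSpace α] {ν : Measure α} {ψ : α → E} {S : E →L[𝕜] E}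

theorem isSymmetric_of_inner_eq_integral
    (hS : ∀ u v, inner 𝕜 u (S v) = ∫ a, inner 𝕜 u (ψ a) * inner 𝕜 (ψ a) v ∂ν) :
    (S : E →ₗ[𝕜] E).IsSymmetric := by
  intro u v
  simp only [ContinuousLinearMap.coe_coe]
  rw [← inner_conj_symm, hS, hS, ← integral_conj]
  simp only [map_mul, inner_conj_symm, mul_comm]

theorem hasSum_integral_inner_mul_inner [Countable ι] [IsFiniteMeasure ν]
    (hψ : AEStronglyMeasurable ψ ν) {R : ℝ} (hR : ∀ a, ‖ψ a‖ ≤ R) (S : E →L[𝕜] E)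
    (b : HilbertBasis ι 𝕜 E) :
    HasSum (fun i => ∫ a, inner 𝕜 (ψ a) (b i) * inner 𝕜 (b i) (S (ψ a)) ∂ν)
      (∫ a, inner 𝕜 (ψ a) (S (ψ a)) ∂ν) := by
  have hSψ : AEStronglyMeasurable (fun a => S (ψ a)) ν := S.continuous.comp_aestronglyMeasurable hψ
  have norm_mul_norm_le (a : α) : ‖ψ a‖ * ‖S (ψ a)‖ ≤ R * (‖S‖ * R) := by
    have hR₀ : 0 ≤ R := (norm_nonneg _).trans (hR a)
    gcongr
    · exact hR a
    · exact S.le_of_opNorm_le_of_le le_rfl (hR a)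
  have integrable_term (i : ι) :
      Integrable (fun a => inner 𝕜 (ψ a) (b i) * inner 𝕜 (b i) (S (ψ a))) ν := by
    refine Integrable.of_bound
      ((hψ.inner aestronglyMeasurable_const).mul (aestronglyMeasurable_const.inner hSψ))
      (R * (‖S‖ * R)) (Filter.Eventually.of_forall fun a => ?_)
    have := sum_norm_inner_mul_norm_inner_le b.orthonormal (ψ a) (S (ψ a)) {i}
    rw [norm_mul]
    exact (by simpa using this : _ ≤ _).trans (norm_mul_norm_le a)
  have summable_norm :
      Summable fun i => ∫ a, ‖inner 𝕜 (ψ a) (b i) * inner 𝕜 (b i) (S (ψ a))‖ ∂ν := by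
    refine summable_of_sum_le (c := ∫ _, R * (‖S‖ * R) ∂ν)
      (fun i => integral_nonneg fun _ => norm_nonneg _) fun s => ?_
    rw [← integral_finsetSum s fun i _ => (integrable_term i).norm]
    refine integral_mono (integrable_finsetSum s fun i _ => (integrable_term i).norm)
      (integrable_const _) fun a => ?_
    simp only [norm_mul]
    exact (sum_norm_inner_mul_norm_inner_le b.orthonormal _ _ s).trans (norm_mul_norm_le a)
  simpa only [b.tsum_inner_mul_inner] using
    hasSum_integral_of_summable_integral_norm integrable_term summable_norm

theorem hasSum_norm_sq_of_inner_eq_integral [Countable ι] [IsFiniteMeasure ν]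
    (hψ : AEStronglyMeasurable ψ ν) {R : ℝ} (hR : ∀ a, ‖ψ a‖ ≤ R)
    (hS : ∀ u v, inner 𝕜 u (S v) = ∫ a, inner 𝕜 u (ψ a) * inner 𝕜 (ψ a) v ∂ν)
    (b : HilbertBasis ι 𝕜 E) :
    HasSum (fun i => ‖S (b i)‖ ^ 2) (∫ a, ∫ a', ‖inner 𝕜 (ψ a) (ψ a')‖ ^ 2 ∂ν ∂ν) := by
  have integral_term (i : ι) : ∫ a, inner 𝕜 (ψ a) (b i) * inner 𝕜 (b i) (S (ψ a)) ∂ν =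
      ((‖S (b i)‖ ^ 2 : ℝ) : 𝕜) := by
    push_cast
    rw [← inner_self_eq_norm_sq_to_K, hS]
    refine integral_congr_ae (Filter.Eventually.of_forall fun a => ?_)
    simp only [mul_comm (inner 𝕜 (ψ a) (b i))]
    exact congrArg (· * _) (isSymmetric_of_inner_eq_integral hS (b i) (ψ a)).symm
  have inner_apply_self (a : α) :
      inner 𝕜 (ψ a) (S (ψ a)) = ((∫ a', ‖inner 𝕜 (ψ a) (ψ a')‖ ^ 2 ∂ν : ℝ) : 𝕜) := by
    rw [hS, ← integral_ofReal]
    refine integral_congr_ae (Filter.Eventually.of_forall fun a' => ?_)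
    simp only [← inner_conj_symm (ψ a') (ψ a), RCLike.mul_conj, RCLike.ofReal_pow]
  have h := hasSum_integral_inner_mul_inner hψ hR S b
  simp_rw [integral_term, inner_apply_self, integral_ofReal] at h
  exact RCLike.hasSum_ofReal _ |>.mp h

end Mixture

end HilbertSpace

/-! ### Trace and Hilbert-Schmidt norm -/

theorem exists_isNuclearRepresentation (T : TraceClass) :
    ∃ x y : ℕ → H, IsNuclearRepresentation (T : H →L[ℂ] H) x y := by
  obtain ⟨x, y, hs, hT⟩ := T.2
  exact ⟨x, y, hs, hT⟩

theorem hasSum_trace (T : TraceClass) {ι : Type*} (b : HilbertBasis ι ℂ H) :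
    HasSum (fun i => inner ℂ (b i) ((T : H →L[ℂ] H) (b i))) (trace T) := by
  obtain ⟨x, y, h⟩ := exists_isNuclearRepresentation T
  rw [trace, (h.hasSum_inner_basis basis).tsum_eq]
  exact h.hasSum_inner_basis b

theorem trace_smul (c : ℂ) (T : TraceClass) : trace (c • T) = c * trace T := by
  simp only [trace, Submodule.coe_smul, smul_apply, inner_smul_right, tsum_mul_left]

theorem trace_sum {ι : Type*} (s : Finset ι) (T : ι → TraceClass) :
    trace (∑ k ∈ s, T k) = ∑ k ∈ s, trace (T k) := by
  simp only [trace, Submodule.coe_sum, sum_apply, inner_sum]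
  exact Summable.tsum_finsetSum fun k _ => (hasSum_trace (T k) basis).summable

theorem trace_add (S T : TraceClass) : trace (S + T) = trace S + trace T := by
  simpa only [Fin.sum_univ_two, Matrix.cons_val] using trace_sum Finset.univ ![S, T]

theorem trace_zero : trace 0 = 0 := by
  simpa only [zero_smul, zero_mul] using trace_smul 0 0

theorem trace_ketbra (φ : H) : trace (ketbra φ) = (‖φ‖ : ℂ) ^ 2 := by
  simp only [trace, ketbra, rankOne_apply, inner_smul_right, basis.tsum_inner_mul_inner]
  exact inner_self_eq_norm_sq_to_K φ

theorem ketbra_zero : ketbra 0 = 0 := by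
  ext1
  simp [ketbra]

theorem summable_norm_basis_sq (T : TraceClass) :
    Summable fun i => ‖(T : H →L[ℂ] H) (basis i)‖ ^ 2 := by
  obtain ⟨x, y, h⟩ := exists_isNuclearRepresentation T
  set A : H →L[ℂ] H := (T : H →L[ℂ] H)
  convert (((h.comp_left A.adjoint).hasSum_inner_basis basis).mapL Complex.reCLM).summable
    using 2 with i
  exact A.apply_norm_sq_eq_inner_adjoint_right (basis i)

theorem hsNormSq_eq_toReal (T : TraceClass) :
    hsNormSq T = (∑' i, ‖(T : H →L[ℂ] H) (basis i)‖ₑ ^ 2).toReal := by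
  rw [hsNormSq, ENNReal.tsum_toReal_eq fun i => ENNReal.pow_ne_top enorm_ne_top]
  simp only [ENNReal.toReal_pow, toReal_enorm]

theorem krausMap_apply (K : H →L[ℂ] H) (T : TraceClass) (v : H) :
    (krausMap K T : H →L[ℂ] H) v = K ((T : H →L[ℂ] H) (K.adjoint v)) := rfl

theorem hsNormSq_krausMap_of_isometry {V : H →L[ℂ] H} (hV : ∀ v, ‖V v‖ = ‖v‖) (T : TraceClass) :
    hsNormSq (krausMap V T) = hsNormSq T := by
  have enorm_V (v : H) : ‖V v‖ₑ = ‖v‖ₑ := by rw [← ofReal_norm, hV, ofReal_norm]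
  set A : H →L[ℂ] H := (T : H →L[ℂ] H)
  rw [hsNormSq_eq_toReal, hsNormSq_eq_toReal]
  congr 1
  calc ∑' i, ‖V ((A ∘L V.adjoint) (basis i))‖ₑ ^ 2
      = ∑' i, ‖(A ∘L V.adjoint) (basis i)‖ₑ ^ 2 := by simp only [enorm_V]
    _ = ∑' i, ‖V (A.adjoint (basis i))‖ₑ ^ 2 := by
        rw [← tsum_enorm_adjoint_sq basis basis, ContinuousLinearMap.adjoint_comp,
          ContinuousLinearMap.adjoint_adjoint]
        rfl
    _ = ∑' i, ‖A (basis i)‖ₑ ^ 2 := by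
        simp only [enorm_V, tsum_enorm_adjoint_sq basis basis]

theorem hsNormSq_smul (c : ℂ) (T : TraceClass) : hsNormSq (c • T) = ‖c‖ ^ 2 * hsNormSq T := by
  simp only [hsNormSq, Submodule.coe_smul, smul_apply, norm_smul, mul_pow, tsum_mul_left]

theorem hsNormSq_ketbra (φ : H) : hsNormSq (ketbra φ) = (‖φ‖ ^ 2) ^ 2 := by
  simp only [hsNormSq, ketbra, rankOne_apply, norm_smul, mul_pow, norm_inner_symm φ,
    tsum_mul_right, (hasSum_norm_inner_sq basis φ).tsum_eq, sq (‖φ‖ ^ 2)]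

theorem hsNormSq_krausMap_add_krausMap {P Q : H →L[ℂ] H} (hPQ : P.adjoint ∘L Q = 0)
    (S T : TraceClass) :
    hsNormSq (krausMap P S + krausMap Q T) = hsNormSq (krausMap P S) + hsNormSq (krausMap Q T) := by
  have orthogonal (u v : H) : inner ℂ (P u) (Q v) = 0 := by
    rw [← P.adjoint_inner_right, ← ContinuousLinearMap.comp_apply, hPQ, zero_apply,
      inner_zero_right]
  rw [hsNormSq, hsNormSq, hsNormSq,
    ← (summable_norm_basis_sq _).tsum_add (summable_norm_basis_sq _)]
  refine tsum_congr fun i => ?_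
  simp only [Submodule.coe_add, add_apply, krausMap_apply, sq]
  exact norm_add_sq_eq_norm_sq_add_norm_sq_of_inner_eq_zero _ _ (orthogonal _ _)

/-! ### Operations with Kraus operators -/

theorem krausMap_comp (A B : H →L[ℂ] H) : krausMap (A ∘L B) = krausMap A ∘ₗ krausMap B := by
  ext T v : 3
  simp only [krausMap_apply, ContinuousLinearMap.adjoint_comp, ContinuousLinearMap.comp_apply,
    LinearMap.comp_apply]

theorem krausMap_smul (c : ℂ) (K : H →L[ℂ] H) :
    krausMap (c • K) = ((‖c‖ : ℂ) ^ 2) • krausMap K := by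
  ext T v : 3
  simp only [krausMap_apply, map_smulₛₗ, smul_apply, smul_smul, LinearMap.smul_apply,
    Submodule.coe_smul, ← Complex.mul_conj', mul_comm, RingHom.id_apply]

theorem krausMap_ketbra (K : H →L[ℂ] H) (φ : H) : krausMap K (ketbra φ) = ketbra (K φ) := by
  ext v : 2
  simp only [krausMap_apply, ketbra, rankOne_apply, K.adjoint_inner_right, map_smul]

theorem isCompletelyPositive_krausMap (K : H →L[ℂ] H) : IsCompletelyPositive (krausMap K) := by
  intro n T hT v
  simpa only [krausMap_apply, K.adjoint_inner_left] using hT fun i => K.adjoint (v i)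

theorem isCompletelyPositive_sum {ι : Type*} {s : Finset ι} {Λ : ι → (TraceClass →ₗ[ℂ] TraceClass)}
    (h : ∀ k ∈ s, IsCompletelyPositive (Λ k)) : IsCompletelyPositive (∑ k ∈ s, Λ k) := by
  intro n T hT v
  simp only [LinearMap.sum_apply, Submodule.coe_sum, sum_apply, inner_sum]
  rw [Finset.sum_comm_cycle]
  exact Finset.sum_nonneg fun k hk => h k hk n T hT v

theorem hasSum_trace_krausMap (K : H →L[ℂ] H) (T : TraceClass) :
    HasSum (fun i => inner ℂ (basis i) ((K.adjoint ∘L K) ((T : H →L[ℂ] H) (basis i))))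
      (trace (krausMap K T)) := by
  obtain ⟨x, y, h⟩ := exists_isNuclearRepresentation T
  have hKT := ((h.comp_adjoint K).comp_left K).hasSum_inner_basis basis
  have hKKT := (h.comp_left (K.adjoint ∘L K)).hasSum_inner_basis basis
  simp only [ContinuousLinearMap.comp_apply, K.adjoint_inner_right] at hKT hKKT ⊢
  exact (hKT.unique (hasSum_trace (krausMap K T) basis)) ▸ hKKT

theorem isTracePreserving_sum_krausMap {ι : Type*} {s : Finset ι} {K : ι → (H →L[ℂ] H)}
    (hK : ∑ j ∈ s, (K j).adjoint ∘L K j = ContinuousLinearMap.id ℂ H) :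
    IsTracePreserving (∑ j ∈ s, krausMap (K j)) := by
  intro T
  rw [LinearMap.sum_apply, trace_sum]
  refine (hasSum_sum fun j _ => hasSum_trace_krausMap (K j) T).unique ?_
  simpa only [← inner_sum, ← sum_apply, hK, ContinuousLinearMap.id_apply] using hasSum_trace T basis

/-! ### Dephasing-covariant operations -/

section Covariance

variable {ħ : ℝ} {μ : Measure ℝ} [IsProbabilityMeasure μ]

theorem dephase_apply (T : TraceClass) (v : H) :
    (dephase ħ μ T : H →L[ℂ] H) v = ∫ p, (krausMap (kick ħ p) T : H →L[ℂ] H) v ∂μ := rfl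

theorem isDephasingCovariant_krausMap_of_comm {K : H →L[ℂ] H}
    (hK : ∀ p, krausMap K ∘ₗ krausMap (kick ħ p) = krausMap (kick ħ p) ∘ₗ krausMap K) :
    IsDephasingCovariant ħ μ (krausMap K) := by
  ext T v : 3
  simp only [LinearMap.comp_apply, krausMap_apply K, dephase_apply]
  refine (K.integral_comp_comm (integrable_kick_conj ħ μ _ _)).symm.trans ?_
  exact integral_congr_ae (Filter.Eventually.of_forall fun p =>
    congrArg (fun Λ : TraceClass →ₗ[ℂ] TraceClass => (Λ T : H →L[ℂ] H) v) (hK p))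

theorem isDephasingCovariant_krausMap {K : H →L[ℂ] H} {c : ℝ → ℂ} (hc : ∀ p, ‖c p‖ = 1)
    (hK : ∀ p, kick ħ p ∘L K = c p • (K ∘L kick ħ p)) :
    IsDephasingCovariant ħ μ (krausMap K) := by
  refine isDephasingCovariant_krausMap_of_comm fun p => ?_
  rw [← krausMap_comp, ← krausMap_comp, hK, krausMap_smul, hc, Complex.ofReal_one, one_pow,
    one_smul]

theorem IsDephasingCovariant.apply {Λ : TraceClass →ₗ[ℂ] TraceClass}
    (h : IsDephasingCovariant ħ μ Λ) (T : TraceClass) :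
    Λ (dephase ħ μ T) = dephase ħ μ (Λ T) :=
  LinearMap.congr_fun h T

theorem IsDephasingCovariant.comp {Λ Λ' : TraceClass →ₗ[ℂ] TraceClass}
    (h : IsDephasingCovariant ħ μ Λ) (h' : IsDephasingCovariant ħ μ Λ') :
    IsDephasingCovariant ħ μ (Λ ∘ₗ Λ') := by
  rw [IsDephasingCovariant, LinearMap.comp_assoc, h', ← LinearMap.comp_assoc, h,
    LinearMap.comp_assoc]

theorem isDephasingCovariant_sum {ι : Type*} {s : Finset ι}
    {Λ : ι → (TraceClass →ₗ[ℂ] TraceClass)} (h : ∀ k ∈ s, IsDephasingCovariant ħ μ (Λ k)) :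
    IsDephasingCovariant ħ μ (∑ k ∈ s, Λ k) := by
  ext T : 1
  simp only [LinearMap.comp_apply, LinearMap.sum_apply, map_sum]
  exact Finset.sum_congr rfl fun k hk => (h k hk).apply T

theorem isDIOInstrument_krausMap {n : ℕ} {K : Fin n → (H →L[ℂ] H)}
    (hcov : ∀ j, IsDephasingCovariant ħ μ (krausMap (K j)))
    (hK : ∑ j, (K j).adjoint ∘L K j = ContinuousLinearMap.id ℂ H) :
    IsDIOInstrument ħ μ fun j => krausMap (K j) where
  completelyPositive j := isCompletelyPositive_krausMap (K j)
  covariant := hcov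
  sum_isDIO := ⟨isCompletelyPositive_sum fun j _ => isCompletelyPositive_krausMap (K j),
    isTracePreserving_sum_krausMap hK, isDephasingCovariant_sum fun j _ => hcov j⟩

theorem l2Loss_smul (c : ℂ) (T : TraceClass) :
    l2Loss ħ μ (c • T) = ‖c‖ ^ 2 * l2Loss ħ μ T := by
  rw [l2Loss, l2Loss, map_smul, hsNormSq_smul, hsNormSq_smul, mul_sub]

theorem l2Loss_krausMap_of_isometry {V : H →L[ℂ] H} (hV : ∀ v, ‖V v‖ = ‖v‖)
    (hcov : IsDephasingCovariant ħ μ (krausMap V)) (T : TraceClass) :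
    l2Loss ħ μ (krausMap V T) = l2Loss ħ μ T := by
  rw [l2Loss, l2Loss, ← hcov.apply, hsNormSq_krausMap_of_isometry hV,
    hsNormSq_krausMap_of_isometry hV]

theorem l2Loss_krausMap_add_krausMap {P Q : H →L[ℂ] H}
    (hP : IsDephasingCovariant ħ μ (krausMap P)) (hQ : IsDephasingCovariant ħ μ (krausMap Q))
    (hPQ : P.adjoint ∘L Q = 0) (S T : TraceClass) :
    l2Loss ħ μ (krausMap P S + krausMap Q T) =
      l2Loss ħ μ (krausMap P S) + l2Loss ħ μ (krausMap Q T) := by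
  simp only [l2Loss, map_add, ← hP.apply, ← hQ.apply, hsNormSq_krausMap_add_krausMap hPQ]
  ring

end Covariance

/-! ### Multiplication and translation operators -/

theorem mulOp_comm (f g : ℝ → ℂ) (hf : MemLp f ∞ volume) (hg : MemLp g ∞ volume) :
    mulOp f hf ∘L mulOp g hg = mulOp g hg ∘L mulOp f hf := by
  ext1 φ
  refine Lp.ext ?_
  simp only [ContinuousLinearMap.comp_apply]
  filter_upwards [mulOp_coe f hf (mulOp g hg φ), mulOp_coe g hg φ, mulOp_coe g hg (mulOp f hf φ),
    mulOp_coe f hf φ] with x hfg hg hgf hf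
  rw [hfg, hg, hgf, hf, mul_left_comm]

theorem adjoint_mulOp (f : ℝ → ℂ) (hf : MemLp f ∞ volume) :
    (mulOp f hf).adjoint = mulOp (star f) hf.star := by
  symm
  rw [ContinuousLinearMap.eq_adjoint_iff]
  intro φ χ
  rw [L2.inner_def, L2.inner_def]
  refine integral_congr_ae ?_
  filter_upwards [mulOp_coe (star f) hf.star φ, mulOp_coe f hf χ] with x hφ hχ
  simp only [hφ, hχ, RCLike.inner_apply, Pi.star_apply, map_mul, RCLike.star_def, RCLike.conj_conj]
  ring

section Projection

variable {S T : Set ℝ} (hS : MeasurableSet S) (hT : MeasurableSet T)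

theorem projOp_coe (φ : H) : projOp S hS φ =ᵐ[volume] S.indicator φ := by
  filter_upwards [mulOp_coe _ (memLp_top_const (1 : ℂ) |>.indicator hS) φ] with x hx
  rw [projOp, hx, ← Set.indicator_mul_left]
  simp only [one_mul]

theorem adjoint_projOp : (projOp S hS).adjoint = projOp S hS := by
  have star_indicator : star (S.indicator fun _ => (1 : ℂ)) = S.indicator fun _ => 1 := by
    ext x
    by_cases hx : x ∈ S <;> simp [hx]
  simp only [projOp, adjoint_mulOp, star_indicator]

theorem projOp_comp_projOp : projOp S hS ∘L projOp T hT = projOp (S ∩ T) (hS.inter hT) := by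
  ext1 φ
  refine Lp.ext ?_
  filter_upwards [projOp_coe hS (projOp T hT φ), projOp_coe hT φ, projOp_coe (hS.inter hT) φ]
    with x hST hT hinter
  rw [ContinuousLinearMap.comp_apply, hST, hinter, ← Set.indicator_indicator]
  exact Set.indicator_eq_indicator Iff.rfl hT

theorem projOp_comp_projOp_of_disjoint (h : Disjoint S T) :
    projOp S hS ∘L projOp T hT = 0 := by
  ext1 φ
  refine Lp.ext ?_
  filter_upwards [projOp_coe (hS.inter hT) φ, Lp.coeFn_zero ℂ 2 volume] with x hinter hzero
  rw [projOp_comp_projOp, hinter, h.inter_eq, Set.indicator_empty, zero_apply, hzero, Pi.zero_apply]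

theorem projOp_eq_self {φ : H} (h : ∀ᵐ x, x ∉ S → φ x = 0) : projOp S hS φ = φ := by
  refine Lp.ext ?_
  filter_upwards [projOp_coe hS φ, h] with x hx hvanish
  rw [hx]
  by_cases hxS : x ∈ S
  · rw [Set.indicator_of_mem hxS]
  · rw [Set.indicator_of_notMem hxS, hvanish hxS]

theorem projOp_add_projOp_add_projOp_compl (h : Disjoint S T) :
    projOp S hS + projOp T hT + projOp (S ∪ T)ᶜ (hS.union hT).compl =
      ContinuousLinearMap.id ℂ H := by
  ext1 φ
  refine Lp.ext ?_
  filter_upwards [Lp.coeFn_add (projOp S hS φ + projOp T hT φ)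
      (projOp (S ∪ T)ᶜ (hS.union hT).compl φ), Lp.coeFn_add (projOp S hS φ) (projOp T hT φ),
    projOp_coe hS φ, projOp_coe hT φ, projOp_coe (hS.union hT).compl φ]
    with x hadd₂ hadd₁ hS hT hST
  rw [add_apply, add_apply, hadd₂, Pi.add_apply, hadd₁, Pi.add_apply, hS, hT, hST,
    ← congrFun (Set.indicator_union_of_disjoint h φ) x]
  exact Set.indicator_self_add_compl_apply (S ∪ T) φ x

end Projection

theorem transOp_coe (a : ℝ) (φ : H) : transOp a φ =ᵐ[volume] fun x => φ (x - a) :=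
  Lp.coeFn_compMeasurePreserving φ (measurePreserving_sub_right volume a)

theorem ae_sub_right {P : ℝ → Prop} (h : ∀ᵐ x, P x) (a : ℝ) : ∀ᵐ x, P (x - a) :=
  (measurePreserving_sub_right volume a).quasiMeasurePreserving.ae h

theorem norm_transOp (a : ℝ) (φ : H) : ‖transOp a φ‖ = ‖φ‖ := LinearIsometry.norm_map _ φ

theorem adjoint_transOp_comp_transOp (a : ℝ) :
    (transOp a).adjoint ∘L transOp a = ContinuousLinearMap.id ℂ H :=
  (transOp a).norm_map_iff_adjoint_comp_self.mp (norm_transOp a)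

theorem transOp_neg_transOp (a : ℝ) (φ : H) : transOp (-a) (transOp a φ) = φ := by
  refine Lp.ext ?_
  filter_upwards [transOp_coe (-a) (transOp a φ), ae_sub_right (transOp_coe a φ) (-a)]
    with x hneg ha
  rw [hneg, ha, sub_neg_eq_add, add_sub_cancel_right]

theorem projOp_shift_transOp {C : Set ℝ} (hC : MeasurableSet C) (a : ℝ) (φ : H) :
    projOp (shift C a) (measurableSet_shift hC a) (transOp a φ) = transOp a (projOp C hC φ) := by
  refine Lp.ext ?_
  filter_upwards [projOp_coe (measurableSet_shift hC a) (transOp a φ), transOp_coe a φ,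
    transOp_coe a (projOp C hC φ), ae_sub_right (projOp_coe hC φ) a] with x hproj htrans hcomp hC
  rw [hproj, hcomp, hC]
  exact Set.indicator_eq_indicator Iff.rfl htrans

theorem kick_comp_projOp (ħ p : ℝ) {S : Set ℝ} (hS : MeasurableSet S) :
    kick ħ p ∘L projOp S hS = projOp S hS ∘L kick ħ p := mulOp_comm _ _ _ _

theorem kickFun_add (ħ p q x : ℝ) : kickFun ħ (p + q) x = kickFun ħ p x * kickFun ħ q x := by
  rw [kickFun, kickFun, kickFun, ← Complex.exp_add]
  push_cast
  ring_nf

theorem kickFun_add_right (ħ p x y : ℝ) :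
    kickFun ħ p (x + y) = kickFun ħ p x * kickFun ħ p y := by
  rw [kickFun, kickFun, kickFun, ← Complex.exp_add]
  push_cast
  ring_nf

theorem kick_comp_transOp (ħ p a : ℝ) :
    kick ħ p ∘L transOp a = kickFun ħ p a • (transOp a ∘L kick ħ p) := by
  ext1 φ
  refine Lp.ext ?_
  simp only [ContinuousLinearMap.comp_apply, smul_apply]
  filter_upwards [kick_coe ħ p (transOp a φ), transOp_coe a φ,
    Lp.coeFn_smul (kickFun ħ p a) (transOp a (kick ħ p φ)), transOp_coe a (kick ħ p φ),
    ae_sub_right (kick_coe ħ p φ) a] with x hkick htrans hsmul htrans' hkick'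
  rw [hkick, htrans, hsmul, Pi.smul_apply, htrans', hkick', smul_eq_mul, ← mul_assoc,
    ← kickFun_add_right, add_sub_cancel]

theorem kick_add (ħ p q : ℝ) : kick ħ (p + q) = kick ħ p ∘L kick ħ q := by
  ext1 φ
  refine Lp.ext ?_
  filter_upwards [kick_coe ħ (p + q) φ, kick_coe ħ p (kick ħ q φ), kick_coe ħ q φ]
    with x hadd hp hq
  rw [hadd, ContinuousLinearMap.comp_apply, hp, hq, kickFun_add, mul_assoc]

section Covariance

variable {ħ : ℝ} {μ : Measure ℝ} [IsProbabilityMeasure μ]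

theorem isDephasingCovariant_projOp {S : Set ℝ} (hS : MeasurableSet S) :
    IsDephasingCovariant ħ μ (krausMap (projOp S hS)) :=
  isDephasingCovariant_krausMap (c := 1) (fun _ => norm_one) fun p => by
    rw [kick_comp_projOp, Pi.one_apply, one_smul]

theorem isDephasingCovariant_transOp (a : ℝ) : IsDephasingCovariant ħ μ (krausMap (transOp a)) :=
  isDephasingCovariant_krausMap (fun p => norm_kickFun ħ p a) fun p => kick_comp_transOp ħ p a

theorem isDephasingCovariant_transOp_comp_projOp (a : ℝ) {S : Set ℝ} (hS : MeasurableSet S) :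
    IsDephasingCovariant ħ μ (krausMap (transOp a ∘L projOp S hS)) := by
  rw [krausMap_comp]
  exact (isDephasingCovariant_transOp a).comp (isDephasingCovariant_projOp hS)

end Covariance

/-! ### The two-packet mixture -/

theorem isState_ketbra {φ : H} (hφ : ‖φ‖ = 1) : IsState (ketbra φ) :=
  ⟨isPositive_rankOne_self φ, by rw [trace_ketbra, hφ, Complex.ofReal_one, one_pow]⟩

theorem IsState.smul_add_smul {ρ σ : TraceClass} (hρ : IsState ρ) (hσ : IsState σ) {s t : ℂ}
    (hs : 0 ≤ s) (ht : 0 ≤ t) (hst : s + t = 1) : IsState (s • ρ + t • σ) :=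
  ⟨(hρ.1.smul_of_nonneg hs).add (hσ.1.smul_of_nonneg ht), by
    rw [trace_add, trace_smul, trace_smul, hρ.2, hσ.2, mul_one, mul_one, hst]⟩

theorem isState_packetMixture {φ : H} (hφ : ‖φ‖ = 1) (a b : ℝ) : IsState (packetMixture φ a b) :=
  have isState_packet (c : ℝ) : IsState (ketbra (transOp c φ)) :=
    isState_ketbra ((norm_transOp c φ).trans hφ)
  have half_nonneg : (0 : ℂ) ≤ 1 / 2 := by norm_num [Complex.le_def]
  (isState_packet a).smul_add_smul (isState_packet b) half_nonneg half_nonneg (by norm_num)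

theorem adjoint_comp_self_projOp {S : Set ℝ} (hS : MeasurableSet S) :
    (projOp S hS).adjoint ∘L projOp S hS = projOp S hS := by
  simp only [adjoint_projOp, projOp_comp_projOp, Set.inter_self]

theorem adjoint_comp_self_transOp_comp_projOp (a : ℝ) {S : Set ℝ} (hS : MeasurableSet S) :
    (transOp a ∘L projOp S hS).adjoint ∘L (transOp a ∘L projOp S hS) = projOp S hS := by
  rw [ContinuousLinearMap.adjoint_comp, ContinuousLinearMap.comp_assoc,
    ← ContinuousLinearMap.comp_assoc (transOp a).adjoint, adjoint_transOp_comp_transOp,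
    ContinuousLinearMap.id_comp, adjoint_comp_self_projOp]

theorem sum_adjoint_comp_self_packetKraus {C : Set ℝ} (hC : MeasurableSet C) {a b : ℝ}
    (hab : Disjoint (shift C a) (shift C b)) :
    ∑ j, (packetKraus C hC a b j).adjoint ∘L packetKraus C hC a b j =
      ContinuousLinearMap.id ℂ H := by
  simp only [Fin.sum_univ_three, packetKraus, Matrix.cons_val,
    adjoint_comp_self_transOp_comp_projOp, adjoint_comp_self_projOp]
  exact projOp_add_projOp_add_projOp_compl _ _ hab

theorem isDIOInstrument_packetInstrument {ħ : ℝ} {μ : Measure ℝ} [IsProbabilityMeasure μ]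
    {C : Set ℝ} (hC : MeasurableSet C) {a b : ℝ} (hab : Disjoint (shift C a) (shift C b)) :
    IsDIOInstrument ħ μ (packetInstrument C hC a b) := by
  refine isDIOInstrument_krausMap (fun j => ?_) (sum_adjoint_comp_self_packetKraus hC hab)
  have hA := measurableSet_shift hC a
  have hB := measurableSet_shift hC b
  fin_cases j
  · exact isDephasingCovariant_transOp_comp_projOp (-a) hA
  · exact isDephasingCovariant_transOp_comp_projOp (-b) hB
  · exact isDephasingCovariant_projOp (hA.union hB).compl

theorem projOp_shift_transOp_eq_self {φ : H} {C : Set ℝ} (hC : MeasurableSet C)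
    (hφ : ∀ᵐ x, x ∉ C → φ x = 0) (c : ℝ) :
    projOp (shift C c) (measurableSet_shift hC c) (transOp c φ) = transOp c φ := by
  rw [projOp_shift_transOp hC, projOp_eq_self hC hφ]

theorem projOp_transOp_eq_zero {φ : H} {C S : Set ℝ} (hC : MeasurableSet C)
    (hφ : ∀ᵐ x, x ∉ C → φ x = 0) (hS : MeasurableSet S) {c : ℝ} (h : Disjoint S (shift C c)) :
    projOp S hS (transOp c φ) = 0 := by
  rw [← projOp_shift_transOp_eq_self hC hφ, ← ContinuousLinearMap.comp_apply,
    projOp_comp_projOp_of_disjoint _ _ h, zero_apply]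

namespace IsPacketPair

variable {φ : H} {C : Set ℝ} {a b : ℝ}

theorem packetKraus_transOp_left (h : IsPacketPair φ C a b) :
    (packetKraus C h.measurable a b · (transOp a φ)) = ![φ, 0, 0] := by
  funext k
  fin_cases k
  · change transOp (-a) (projOp _ _ (transOp a φ)) = φ
    rw [projOp_shift_transOp_eq_self h.measurable h.vanish, transOp_neg_transOp]
  · change transOp (-b) (projOp _ _ (transOp a φ)) = 0
    rw [projOp_transOp_eq_zero h.measurable h.vanish _ h.disjoint.symm, map_zero]
  · have hAB := (measurableSet_shift h.measurable a).union (measurableSet_shift h.measurable b)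
    exact projOp_transOp_eq_zero h.measurable h.vanish hAB.compl
      (Set.disjoint_compl_left_iff_subset.mpr Set.subset_union_left)

theorem packetKraus_transOp_right (h : IsPacketPair φ C a b) :
    (packetKraus C h.measurable a b · (transOp b φ)) = ![0, φ, 0] := by
  funext k
  fin_cases k
  · change transOp (-a) (projOp _ _ (transOp b φ)) = 0
    rw [projOp_transOp_eq_zero h.measurable h.vanish _ h.disjoint, map_zero]
  · change transOp (-b) (projOp _ _ (transOp b φ)) = φ
    rw [projOp_shift_transOp_eq_self h.measurable h.vanish, transOp_neg_transOp]
  · have hAB := (measurableSet_shift h.measurable a).union (measurableSet_shift h.measurable b)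
    exact projOp_transOp_eq_zero h.measurable h.vanish hAB.compl
      (Set.disjoint_compl_left_iff_subset.mpr Set.subset_union_right)

theorem packetInstrument_packetMixture (h : IsPacketPair φ C a b) :
    (packetInstrument C h.measurable a b · (packetMixture φ a b)) =
      ![(1 / 2 : ℂ) • ketbra φ, (1 / 2 : ℂ) • ketbra φ, 0] := by
  funext k
  have left := congrFun h.packetKraus_transOp_left k
  have right := congrFun h.packetKraus_transOp_right k
  simp only [packetInstrument, packetMixture, map_add, map_smul, krausMap_ketbra, left, right]
  fin_cases k <;> simp [ketbra_zero]

theorem branchProb_packetInstrument (h : IsPacketPair φ C a b) :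
    (fun k => branchProb (packetInstrument C h.measurable a b k) (packetMixture φ a b)) =
      ![1 / 2, 1 / 2, 0] := by
  funext k
  rw [branchProb, congrFun h.packetInstrument_packetMixture k]
  fin_cases k <;> simp [trace_smul, trace_zero, (isState_ketbra h.norm_eq_one).2]

theorem branchState_packetInstrument (h : IsPacketPair φ C a b) {k : Fin 3} (hk : k ≠ 2) :
    branchState (packetInstrument C h.measurable a b k) (packetMixture φ a b) = ketbra φ := by
  rw [branchState, congrFun h.branchProb_packetInstrument k,
    congrFun h.packetInstrument_packetMixture k]
  fin_cases k
  · simp [smul_smul]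
  · simp [smul_smul]
  · exact absurd rfl hk

theorem averageAfter_packetInstrument (h : IsPacketPair φ C a b) (F : TraceClass → ℝ) :
    averageAfter F (packetInstrument C h.measurable a b) (packetMixture φ a b) = F (ketbra φ) := by
  simp only [averageAfter, Fin.sum_univ_three, congrFun h.branchProb_packetInstrument _,
    h.branchState_packetInstrument (k := 0) (by decide),
    h.branchState_packetInstrument (k := 1) (by decide), Matrix.cons_val]
  ring

variable {ħ : ℝ} {μ : Measure ℝ} [IsProbabilityMeasure μ]

theorem l2Loss_packetMixture (h : IsPacketPair φ C a b) :
    l2Loss ħ μ (packetMixture φ a b) = 1 / 2 * l2Loss ħ μ (ketbra φ) := by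
  have hA := measurableSet_shift h.measurable a
  have hB := measurableSet_shift h.measurable b
  have localized (c : ℝ) : krausMap (projOp (shift C c) (measurableSet_shift h.measurable c))
      (ketbra (transOp c φ)) = ketbra (transOp c φ) := by
    rw [krausMap_ketbra, projOp_shift_transOp_eq_self h.measurable h.vanish]
  have orthogonal_ranges : (projOp _ hA).adjoint ∘L projOp _ hB = 0 := by
    rw [adjoint_projOp, projOp_comp_projOp_of_disjoint hA hB h.disjoint]
  have loss_packet (c : ℝ) : l2Loss ħ μ (ketbra (transOp c φ)) = l2Loss ħ μ (ketbra φ) := by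
    rw [← krausMap_ketbra, l2Loss_krausMap_of_isometry (norm_transOp c)
      (isDephasingCovariant_transOp c)]
  have loss_add := l2Loss_krausMap_add_krausMap (ħ := ħ) (μ := μ) (isDephasingCovariant_projOp hA)
    (isDephasingCovariant_projOp hB) orthogonal_ranges (ketbra (transOp a φ)) (ketbra (transOp b φ))
  rw [localized, localized, loss_packet, loss_packet] at loss_add
  have norm_half : ‖(1 / 2 : ℂ)‖ = 1 / 2 := by norm_num
  rw [packetMixture, ← smul_add, l2Loss_smul, loss_add, norm_half]
  ring

theorem l2Loss_packetMixture_lt_averageAfter (h : IsPacketPair φ C a b)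
    (hpos : 0 < l2Loss ħ μ (ketbra φ)) :
    l2Loss ħ μ (packetMixture φ a b) <
      averageAfter (l2Loss ħ μ) (packetInstrument C h.measurable a b) (packetMixture φ a b) := by
  rw [h.l2Loss_packetMixture, h.averageAfter_packetInstrument]
  linarith

theorem not_isStronglyMonotone (h : IsPacketPair φ C a b) (hpos : 0 < l2Loss ħ μ (ketbra φ)) :
    ¬ IsStronglyMonotone ħ μ (l2Loss ħ μ) := fun hmono =>
  (h.l2Loss_packetMixture_lt_averageAfter hpos).not_ge <|
    hmono 3 _ (isDIOInstrument_packetInstrument h.measurable h.disjoint) _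
      (isState_packetMixture h.norm_eq_one a b)

end IsPacketPair

theorem exists_isPacketPair : ∃ (φ : H) (C : Set ℝ) (a b : ℝ), IsPacketPair φ C a b := by
  have volume_ne_top : (volume : Measure ℝ) (Set.Ico 0 1) ≠ ∞ := measure_Ico_lt_top.ne
  refine ⟨indicatorConstLp 2 measurableSet_Ico volume_ne_top (1 : ℂ), Set.Ico 0 1, 0, 1, ?_,
    measurableSet_Ico, Metric.isBounded_Ico 0 1, ?_, ?_⟩
  · rw [norm_indicatorConstLp (by norm_num) (by norm_num)]
    simp
  · filter_upwards [indicatorConstLp_coeFn (p := 2) (hs := measurableSet_Ico)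
      (hμs := volume_ne_top) (c := (1 : ℂ))] with x hx hxC
    rw [hx, Set.indicator_of_notMem hxC]
  · rw [Set.disjoint_left]
    rintro x ⟨-, h_lt⟩ ⟨h_ge, -⟩
    linarith

/-! ### Strict positivity of the loss -/

section ProbabilityMeasure

variable {α : Type*} [MeasurableSpace α] {ν : Measure α} [IsProbabilityMeasure ν]

theorem eq_dirac_of_ae_eq {p : α} (h : ∀ᵐ q ∂ν, q = p) : ν = Measure.dirac p := by
  rw [← Measure.map_id (μ := ν), Measure.map_congr (f := id) (g := fun _ => p) h,
    Measure.map_const, measure_univ, one_smul]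

theorem integral_lt_of_le_of_not_ae_le {f : α → ℝ} (hf : Integrable f ν) {c : ℝ}
    (hle : ∀ a, f a ≤ c) (hlt : ¬ ∀ᵐ a ∂ν, c ≤ f a) : ∫ a, f a ∂ν < c := by
  have integral_gap_pos : 0 < ∫ a, (c - f a) ∂ν := by
    rw [integral_pos_iff_support_of_nonneg (fun a => sub_nonneg.mpr (hle a))
      ((integrable_const c).sub hf), pos_iff_ne_zero]
    refine fun hnull => hlt (measure_mono_null (fun a ha => ?_) hnull)
    exact sub_ne_zero.mpr fun hca => ha hca.le
  rw [integral_sub (integrable_const c) hf, integral_const, probReal_univ, one_smul]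
    at integral_gap_pos
  exact sub_pos.mp integral_gap_pos

theorem integral_integral_lt_of_offDiag {f : α × α → ℝ} (hf : Integrable f (ν.prod ν))
    (hf_right : ∀ p, Integrable (fun q => f (p, q)) ν) {c : ℝ} (hle : ∀ z, f z ≤ c)
    (hlt : ∀ p q, p ≠ q → f (p, q) < c) (hν : ∀ p, ν ≠ Measure.dirac p) :
    ∫ p, ∫ q, f (p, q) ∂ν ∂ν < c := by
  have integral_right_lt (p : α) : ∫ q, f (p, q) ∂ν < c :=
    integral_lt_of_le_of_not_ae_le (hf_right p) (fun q => hle (p, q)) fun hc =>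
      hν p <| eq_dirac_of_ae_eq <| hc.mono fun q hq =>
        by_contra fun hqp => (hlt p q (Ne.symm hqp)).not_ge hq
  refine integral_lt_of_le_of_not_ae_le hf.integral_prod_left (fun p => (integral_right_lt p).le)
    fun hc => ?_
  obtain ⟨p, hp⟩ := hc.exists
  exact (integral_right_lt p).not_ge hp

end ProbabilityMeasure

theorem countable_basisIndex : Countable basisIndex := by
  have : Fact ((2 : ℝ≥0∞) ≠ ∞) := ⟨by norm_num⟩
  exact countable_of_orthonormal basis.orthonormal

theorem inner_dephase_ketbra (ħ : ℝ) (μ : Measure ℝ) [IsProbabilityMeasure μ] (φ u v : H) :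
    inner ℂ u ((dephase ħ μ (ketbra φ) : H →L[ℂ] H) v) =
      ∫ p, inner ℂ u (kick ħ p φ) * inner ℂ (kick ħ p φ) v ∂μ := by
  refine (integral_inner (integrable_kick_conj ħ μ (rankOne ℂ φ φ) v) u).symm.trans ?_
  simp only [rankOne_apply, map_smul, inner_smul_right,
    ContinuousLinearMap.adjoint_inner_right, mul_comm]

theorem hsNormSq_dephase_ketbra (ħ : ℝ) (μ : Measure ℝ) [IsProbabilityMeasure μ] (φ : H) :
    hsNormSq (dephase ħ μ (ketbra φ)) =
      ∫ p, ∫ q, ‖inner ℂ (kick ħ p φ) (kick ħ q φ)‖ ^ 2 ∂μ ∂μ :=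
  have := countable_basisIndex
  (hasSum_norm_sq_of_inner_eq_integral (continuous_kick ħ φ).aestronglyMeasurable
    (fun p => (norm_kick ħ p φ).le) (inner_dephase_ketbra ħ μ φ) basis).tsum_eq

theorem countable_setOf_kickFun_eq {ħ r : ℝ} (hħ : ħ ≠ 0) (hr : r ≠ 0) (c : ℂ) :
    {x | kickFun ħ r x = c}.Countable := by
  have phase_injective : Function.Injective fun x : ℝ => ((r * x / ħ : ℝ) : ℂ) * Complex.I := by
    intro x y hxy
    have phase_eq := Complex.ofReal_injective (mul_right_cancel₀ Complex.I_ne_zero hxy)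
    exact mul_left_cancel₀ hr ((div_left_inj' hħ).mp phase_eq)
  exact ((Set.countable_singleton c).preimage_cexp).preimage_of_injOn phase_injective.injOn

theorem eq_zero_of_kick_eq_smul {ħ r : ℝ} (hħ : ħ ≠ 0) (hr : r ≠ 0) {φ : H} {c : ℂ}
    (h : kick ħ r φ = c • φ) : φ = 0 := by
  refine Lp.ext ?_
  filter_upwards [kick_coe ħ r φ, Lp.coeFn_smul c φ, Lp.coeFn_zero ℂ 2 volume,
    (countable_setOf_kickFun_eq hħ hr c).ae_notMem volume] with x hkick hsmul hzero hne
  rw [h, hsmul, Pi.smul_apply, smul_eq_mul] at hkick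
  rw [hzero, Pi.zero_apply]
  by_contra hφx
  exact hne (mul_right_cancel₀ hφx hkick).symm

theorem inner_kick_kick (ħ p q : ℝ) (φ χ : H) :
    inner ℂ (kick ħ p φ) (kick ħ q χ) = inner ℂ φ (kick ħ (q - p) χ) := by
  rw [← ContinuousLinearMap.adjoint_inner_right, adjoint_kick, ← ContinuousLinearMap.comp_apply,
    ← kick_add, neg_add_eq_sub]

theorem norm_inner_kick_kick_le (ħ p q : ℝ) (φ : H) :
    ‖inner ℂ (kick ħ p φ) (kick ħ q φ)‖ ≤ ‖φ‖ ^ 2 := by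
  simpa only [norm_kick, ← sq] using norm_inner_le_norm (𝕜 := ℂ) (kick ħ p φ) (kick ħ q φ)

theorem norm_inner_kick_kick_lt {ħ : ℝ} (hħ : ħ ≠ 0) {p q : ℝ} (hpq : p ≠ q) {φ : H}
    (hφ : φ ≠ 0) : ‖inner ℂ (kick ħ p φ) (kick ħ q φ)‖ < ‖φ‖ ^ 2 := by
  refine (norm_inner_kick_kick_le ħ p q φ).lt_of_ne fun heq => hφ ?_
  have kick_ne_zero : kick ħ (q - p) φ ≠ 0 := by
    rwa [← norm_ne_zero_iff, norm_kick, norm_ne_zero_iff]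
  rw [inner_kick_kick, sq] at heq
  obtain ⟨c, -, hc⟩ := (norm_inner_eq_norm_iff (𝕜 := ℂ) hφ kick_ne_zero).mp (by rw [heq, norm_kick])
  exact eq_zero_of_kick_eq_smul hħ (sub_ne_zero.mpr hpq.symm) hc

theorem l2Loss_ketbra_pos {ħ : ℝ} (hħ : ħ ≠ 0) {μ : Measure ℝ} [IsProbabilityMeasure μ]
    (hμ : ∀ p, μ ≠ Measure.dirac p) {φ : H} (hφ : φ ≠ 0) : 0 < l2Loss ħ μ (ketbra φ) := by
  rw [l2Loss, hsNormSq_ketbra, hsNormSq_dephase_ketbra, sub_pos]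
  have overlap_continuous :
      Continuous fun z : ℝ × ℝ => ‖inner ℂ (kick ħ z.1 φ) (kick ħ z.2 φ)‖ ^ 2 :=
    (((continuous_kick ħ φ).comp continuous_fst).inner
      ((continuous_kick ħ φ).comp continuous_snd)).norm.pow 2
  have overlap_le (z : ℝ × ℝ) :
      ‖inner ℂ (kick ħ z.1 φ) (kick ħ z.2 φ)‖ ^ 2 ≤ (‖φ‖ ^ 2) ^ 2 := by
    gcongr
    exact norm_inner_kick_kick_le ħ z.1 z.2 φ
  have norm_overlap_le (z : ℝ × ℝ) :
      ‖‖inner ℂ (kick ħ z.1 φ) (kick ħ z.2 φ)‖ ^ 2‖ ≤ (‖φ‖ ^ 2) ^ 2 :=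
    (Real.norm_of_nonneg (sq_nonneg _)).trans_le (overlap_le z)
  refine integral_integral_lt_of_offDiag
    (f := fun z => ‖inner ℂ (kick ħ z.1 φ) (kick ħ z.2 φ)‖ ^ 2) ?_ (fun p => ?_) overlap_le
    (fun p q hpq => ?_) hμ
  · exact Integrable.of_bound overlap_continuous.aestronglyMeasurable _
      (Filter.Eventually.of_forall norm_overlap_le)
  · exact Integrable.of_bound
      (overlap_continuous.comp (Continuous.prodMk_right p)).aestronglyMeasurable _
      (Filter.Eventually.of_forall fun q => norm_overlap_le (p, q))
  · have := norm_inner_kick_kick_lt hħ hpq hφ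
    gcongr

end PositionCoherence

theorem mainTheorem5 (ħ : ℝ) (hħ : 0 < ħ) (μ : MeasureTheory.Measure ℝ)
    [MeasureTheory.IsProbabilityMeasure μ]
    (hμ : ∀ p : ℝ, μ ≠ MeasureTheory.Measure.dirac p) :
    ¬ IsStronglyMonotone ħ μ (l2Loss ħ μ) ∧
    (∃ (φ : H) (C : Set ℝ) (a b : ℝ), IsPacketPair φ C a b ∧ 0 < l2Loss ħ μ (ketbra φ)) ∧
    ∀ (φ : H) (C : Set ℝ) (a b : ℝ) (h : IsPacketPair φ C a b),
      (∑ j, (packetKraus C h.measurable a b j).adjoint ∘L packetKraus C h.measurable a b j =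
        ContinuousLinearMap.id ℂ H) ∧
      IsDIOInstrument ħ μ (packetInstrument C h.measurable a b) ∧
      IsState (packetMixture φ a b) ∧
      branchProb (packetInstrument C h.measurable a b 0) (packetMixture φ a b) = 1 / 2 ∧
      branchProb (packetInstrument C h.measurable a b 1) (packetMixture φ a b) = 1 / 2 ∧
      branchProb (packetInstrument C h.measurable a b 2) (packetMixture φ a b) = 0 ∧
      branchState (packetInstrument C h.measurable a b 0) (packetMixture φ a b) = ketbra φ ∧
      branchState (packetInstrument C h.measurable a b 1) (packetMixture φ a b) = ketbra φ ∧
      averageAfter (l2Loss ħ μ) (packetInstrument C h.measurable a b) (packetMixture φ a b) =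
        l2Loss ħ μ (ketbra φ) ∧
      l2Loss ħ μ (packetMixture φ a b) = 1 / 2 * l2Loss ħ μ (ketbra φ) ∧
      (0 < l2Loss ħ μ (ketbra φ) →
        l2Loss ħ μ (packetMixture φ a b) <
          averageAfter (l2Loss ħ μ) (packetInstrument C h.measurable a b)
            (packetMixture φ a b)) := by
  have loss_pos {φ : H} {C : Set ℝ} {a b : ℝ} (h : IsPacketPair φ C a b) :
      0 < l2Loss ħ μ (ketbra φ) :=
    l2Loss_ketbra_pos hħ.ne' hμ (norm_ne_zero_iff.mp (by simp [h.norm_eq_one]))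
  obtain ⟨φ, C, a, b, h⟩ := exists_isPacketPair
  refine ⟨h.not_isStronglyMonotone (loss_pos h), ⟨φ, C, a, b, h, loss_pos h⟩, fun φ C a b h => ?_⟩
  have prob := congrFun h.branchProb_packetInstrument
  exact ⟨sum_adjoint_comp_self_packetKraus h.measurable h.disjoint,
    isDIOInstrument_packetInstrument h.measurable h.disjoint,
    isState_packetMixture h.norm_eq_one a b, prob 0, prob 1, prob 2,
    h.branchState_packetInstrument (by decide), h.branchState_packetInstrument (by decide),
    h.averageAfter_packetInstrument _, h.l2Loss_packetMixture,
    h.l2Loss_packetMixture_lt_averageAfter⟩
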